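/- For $x\in\mathbb R$ let $\|x\|$ denote the distance from $x$ to the nearest integer, and let $\varphi$ be Euler's totient function. Let $\alpha$ be an irrational real number that is not Liouville. Let $$\mu(\alpha)=\sup\{w>0:\ \|n\alpha\|<n^{-w}\text{ for infinitely many } n\in\mathbb N\}$$ be its diophantine exponent, which is finite, and put $\varepsilon=\dfrac{1}{10(1+\mu(\alpha))}$. Then there exist constants $c,C>0$ and $N_0\in\mathbb N$, depending only on $\alpha$, such that for every $\gamma\in\mathbb R$, every integer $N\ge N_0$ and every real $\rho$ with $N^{-2\varepsilon}\le\rho\le N^{-\varepsilon}$, we have $$c\,\rho N\ \le\ \sum_{\substack{N/20\le n\le N\\ \|n\alpha-\gamma\|\le\rho}}\frac{\varphi(n)}{n}\ \le\ C\,\rho N,$$ where the sum runs over positive integers $n$. -/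

import Mathlib

noncomputable section

/-- `‖x‖`: the distance from the real number `x` to the nearest integer. -/
def distNearestInt (x : ℝ) : ℝ := |x - round x|

/-- The diophantine exponent
`μ(α) = sup {w > 0 : ‖n α‖ < n ^ (-w) for infinitely many positive integers n}`.
For `α` irrational and not Liouville the set is nonempty and bounded above, so the supremum
in `ℝ` is the usual one. -/
def diophantineExponent (α : ℝ) : ℝ :=
  sSup {w : ℝ | 0 < w ∧
    {n : ℕ | 1 ≤ n ∧ distNearestInt (n * α) < (n : ℝ) ^ (-w)}.Infinite}

/-- `ε = 1 / (10 λ)`, where `λ = 1 + μ(α)`. -/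
def bohrEps (α : ℝ) : ℝ := 1 / (10 * (1 + diophantineExponent α))

/-- The inhomogeneous Bohr set `{n ∈ ℕ : 1 ≤ n ≤ N, ‖n α - γ‖ ≤ ρ}`. -/
def bohrSet (N : ℕ) (γ α ρ : ℝ) : Finset ℕ :=
  (Finset.Icc 1 N).filter fun n => distNearestInt (n * α - γ) ≤ ρ

/-- The intersection of the Bohr set with `[N / 20, N]`, where `N / 20` is the real quotient. -/
def bohrSetStar (N : ℕ) (γ α ρ : ℝ) : Finset ℕ :=
  (bohrSet N γ α ρ).filter fun n => (N : ℝ) / 20 ≤ n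

end

/-!
A reduced fraction `a / q` with `|β - a / q| ≤ 1 / q ^ 2` makes `n β` run through all the residues
`k / q` modulo `1` on every block of `q` consecutive integers, up to a shift constant on the block
and an error at most `1 / q`, so the block has `2 ρ q + O(1)` solutions of `‖n β - γ‖ ≤ ρ`. Since
`α` is not Liouville, Dirichlet's theorem provides such fractions for every `d α` with `d ≤ N ^ η`,
with denominators `q` between `3 / ρ` and `N / d`. Hence the Bohr set has `≍ ρ N` elements, of which
`O(ρ N / d)` are multiples of `d`. The average over the Bohr set of the sum of `1 / p` over the
primes `p ∣ n` is then bounded, because `∑ 1 / p ^ 2` converges, and convexity of the exponential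
turns this into a lower bound for the average of `φ(n) / n = ∏ (1 - 1 / p)`.
-/

open Filter Topology Asymptotics Finset

theorem distNearestInt_le_iff {x r : ℝ} : distNearestInt x ≤ r ↔ ∃ m : ℤ, |x - m| ≤ r :=
  ⟨fun h => ⟨round x, h⟩, fun ⟨m, hm⟩ => (round_le x m).trans hm⟩

theorem distNearestInt_nonneg (x : ℝ) : 0 ≤ distNearestInt x :=
  abs_nonneg _

theorem distNearestInt_pos_of_irrational {x : ℝ} (hx : Irrational x) : 0 < distNearestInt x :=
  abs_pos.mpr (sub_ne_zero.mpr (hx.ne_int _))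

section IntegersNearReal

theorem mem_Icc_ceil_floor_iff {t r : ℝ} {k : ℤ} :
    k ∈ Icc ⌈t - r⌉ ⌊t + r⌋ ↔ |(k : ℝ) - t| ≤ r := by
  rw [mem_Icc, Int.ceil_le, Int.le_floor, abs_sub_le_iff]
  constructor <;> rintro ⟨h₁, h₂⟩ <;> constructor <;> linarith

theorem card_Icc_ceil_floor_le (t : ℝ) {r : ℝ} (hr : 0 ≤ r) :
    (#(Icc ⌈t - r⌉ ⌊t + r⌋) : ℝ) ≤ 2 * r + 1 := by
  have hcard : (#(Icc ⌈t - r⌉ ⌊t + r⌋) : ℝ) = max ((⌊t + r⌋ : ℝ) + 1 - ⌈t - r⌉) 0 := by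
    rw [Int.card_Icc]
    exact_mod_cast Int.toNat_eq_max _
  rw [hcard]
  exact max_le (by linarith [Int.floor_le (t + r), Int.le_ceil (t - r)]) (by linarith)

theorem le_card_Icc_ceil_floor (t r : ℝ) :
    2 * r - 1 ≤ (#(Icc ⌈t - r⌉ ⌊t + r⌋) : ℝ) := by
  have hcard : (⌊t + r⌋ : ℝ) + 1 - ⌈t - r⌉ ≤ #(Icc ⌈t - r⌉ ⌊t + r⌋) := by
    rw [Int.card_Icc]
    exact_mod_cast Int.self_le_toNat _
  linarith [Int.lt_floor_add_one (t + r), Int.ceil_lt_add_one (t - r)]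

end IntegersNearReal

theorem exists_mem_Ico_mul_eq_add_mul {a : ℤ} {q : ℕ} (hq : 0 < q) (haq : IsCoprime a (q : ℤ))
    (s : ℕ) (k : ℤ) : ∃ n ∈ Ico s (s + q), ∃ m : ℤ, n * a = k + m * q := by
  obtain ⟨u, v, huv⟩ := haq
  obtain ⟨z, hzq, hz⟩ := Int.existsUnique_equiv_nat ((k - s * a) * u) (Int.natCast_pos.mpr hq)
  obtain ⟨m, hm⟩ := hz.symm.dvd
  refine ⟨s + z, by simp only [mem_Ico]; omega, a * m - v * (k - s * a), ?_⟩
  push_cast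
  linear_combination a * hm + (k - s * a) * huv

theorem sum_Ico_add_mul {M : Type*} [AddCommMonoid M] (f : ℕ → M) (s T q : ℕ) :
    ∑ n ∈ Ico s (s + T * q), f n = ∑ i ∈ range T, ∑ n ∈ Ico (s + i * q) (s + i * q + q), f n := by
  induction T with
  | zero => simp
  | succ T ih =>
    rw [sum_range_succ, ← ih, sum_Ico_consecutive f (by omega) (by omega), add_assoc,
      ← Nat.succ_mul]

/-- The elements `n` of `s` with `‖n β - γ‖ ≤ ρ`; this is `bohrSet N γ β ρ` for `s = [1, N]`. Having
`s` arbitrary allows counting over blocks of consecutive integers. -/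
noncomputable def bohrSetOn (s : Finset ℕ) (γ β ρ : ℝ) : Finset ℕ :=
  {n ∈ s | distNearestInt (n * β - γ) ≤ ρ}

theorem mem_bohrSetOn {s : Finset ℕ} {γ β ρ : ℝ} {n : ℕ} :
    n ∈ bohrSetOn s γ β ρ ↔ n ∈ s ∧ distNearestInt (n * β - γ) ≤ ρ :=
  mem_filter

theorem bohrSetOn_subset_bohrSetOn {s t : Finset ℕ} (h : s ⊆ t) (γ β ρ : ℝ) :
    bohrSetOn s γ β ρ ⊆ bohrSetOn t γ β ρ :=
  filter_subset_filter _ h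

theorem card_bohrSetOn_Ico_add_mul (s T q : ℕ) (γ β ρ : ℝ) :
    #(bohrSetOn (Ico s (s + T * q)) γ β ρ) =
      ∑ i ∈ range T, #(bohrSetOn (Ico (s + i * q) (s + i * q + q)) γ β ρ) := by
  simp only [bohrSetOn, card_filter, sum_Ico_add_mul]

/-- The reduced fraction `a / q` approximates `β` as well as Dirichlet's theorem guarantees. -/
structure IsDirichletApprox (β : ℝ) (a : ℤ) (q : ℕ) : Prop where
  pos : 0 < q
  isCoprime : IsCoprime a (q : ℤ)
  abs_sub_le : |β - a / q| ≤ 1 / (q : ℝ) ^ 2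

namespace IsDirichletApprox

variable {β : ℝ} {a : ℤ} {q : ℕ}

theorem mul_abs_sub_le_one (h : IsDirichletApprox β a q) : q * |q * β - a| ≤ 1 := by
  have hq : (0 : ℝ) < q := Nat.cast_pos.mpr h.pos
  calc (q : ℝ) * |q * β - a| = q ^ 2 * |β - a / q| := by
        rw [show (q : ℝ) * β - a = q * (β - a / q) by field_simp, abs_mul, Nat.abs_cast]
        ring
    _ ≤ q ^ 2 * (1 / (q : ℝ) ^ 2) := by gcongr; exact h.abs_sub_le
    _ = 1 := by field_simp

/-- On a block of `q` consecutive integers `n`, replacing `n β` by `n a / q` costs at most `1 / q`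
up to a shift that is constant on the block. -/
theorem abs_block_error_le_one (h : IsDirichletApprox β a q) {s n : ℕ} (hn : n ∈ Ico s (s + q))
    (γ : ℝ) (m : ℤ) :
    |q * (n * β - γ - m) - (((n * a - m * q : ℤ) : ℝ) - (q * γ - s * (q * β - a)))| ≤ 1 := by
  obtain ⟨hsn, hnq⟩ := mem_Ico.mp hn
  have hle : ((n - s : ℕ) : ℝ) ≤ q := by exact_mod_cast (by omega : n - s ≤ q)
  calc _ = |((n - s : ℕ) : ℝ) * (q * β - a)| := by
        push_cast [Nat.cast_sub hsn]
        ring_nf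
    _ = ((n - s : ℕ) : ℝ) * |q * β - a| := by rw [abs_mul, Nat.abs_cast]
    _ ≤ q * |q * β - a| := by gcongr
    _ ≤ 1 := h.mul_abs_sub_le_one

theorem card_bohrSetOn_block_le (h : IsDirichletApprox β a q) (s : ℕ) (γ : ℝ) {ρ : ℝ}
    (hρ : 0 ≤ ρ) : (#(bohrSetOn (Ico s (s + q)) γ β ρ) : ℝ) ≤ 2 * ρ * q + 3 := by
  have hq : (0 : ℝ) < q := Nat.cast_pos.mpr h.pos
  set t : ℝ := q * γ - s * (q * β - a)
  let numerator (n : ℕ) : ℤ := n * a - round (n * β - γ) * q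
  have hmaps : Set.MapsTo numerator (bohrSetOn (Ico s (s + q)) γ β ρ)
      (Icc ⌈t - (q * ρ + 1)⌉ ⌊t + (q * ρ + 1)⌋) := by
    intro n hn
    obtain ⟨hns, hnρ⟩ := mem_bohrSetOn.mp hn
    have hdist : |q * (n * β - γ - round (n * β - γ))| ≤ q * ρ := by
      rw [abs_mul, Nat.abs_cast]
      exact mul_le_mul_of_nonneg_left hnρ hq.le
    have herr := h.abs_block_error_le_one hns γ (round (n * β - γ))
    refine mem_Icc_ceil_floor_iff.mpr ?_
    rw [abs_le] at hdist herr ⊢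
    constructor <;> linarith
  have hinj : Set.InjOn numerator (bohrSetOn (Ico s (s + q)) γ β ρ) := by
    intro n hn m hm hnm
    have hns := mem_Ico.mp (mem_bohrSetOn.mp hn).1
    have hms := mem_Ico.mp (mem_bohrSetOn.mp hm).1
    have hdvd : (q : ℤ) ∣ ((n : ℤ) - m) * a :=
      ⟨round (n * β - γ) - round (m * β - γ), by linear_combination hnm⟩
    have := Int.eq_zero_of_abs_lt_dvd (h.isCoprime.symm.dvd_of_dvd_mul_right hdvd)
      (by rw [abs_lt]; omega)
    omega
  calc (#(bohrSetOn (Ico s (s + q)) γ β ρ) : ℝ)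
      ≤ #(Icc ⌈t - (q * ρ + 1)⌉ ⌊t + (q * ρ + 1)⌋) := by
        exact_mod_cast card_le_card_of_injOn numerator hmaps hinj
    _ ≤ 2 * (q * ρ + 1) + 1 := card_Icc_ceil_floor_le t (by positivity)
    _ = 2 * ρ * q + 3 := by ring

theorem le_card_bohrSetOn_block (h : IsDirichletApprox β a q) (s : ℕ) (γ : ℝ) {ρ : ℝ}
    (hρ : ρ ≤ 1 / 2) : 2 * ρ * q - 3 ≤ (#(bohrSetOn (Ico s (s + q)) γ β ρ) : ℝ) := by
  have hq : (0 : ℝ) < q := Nat.cast_pos.mpr h.pos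
  set t : ℝ := q * γ - s * (q * β - a)
  choose n hns m hnm using exists_mem_Ico_mul_eq_add_mul h.pos h.isCoprime s
  have hmaps : Set.MapsTo n (Icc ⌈t - (q * ρ - 1)⌉ ⌊t + (q * ρ - 1)⌋)
      (bohrSetOn (Ico s (s + q)) γ β ρ) := by
    intro k hk
    refine mem_bohrSetOn.mpr ⟨hns k, distNearestInt_le_iff.mpr ⟨m k, ?_⟩⟩
    have hkt := mem_Icc_ceil_floor_iff.mp hk
    have herr := h.abs_block_error_le_one (hns k) γ (m k)
    rw [hnm k, add_sub_cancel_right] at herr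
    refine le_of_mul_le_mul_left ?_ hq
    rw [← Nat.abs_cast q, ← abs_mul, Nat.abs_cast]
    rw [abs_le] at hkt herr ⊢
    constructor <;> linarith
  have hinj : Set.InjOn n (Icc ⌈t - (q * ρ - 1)⌉ ⌊t + (q * ρ - 1)⌋ : Finset ℤ) := by
    intro k hk l hl hkl
    have hkt := abs_le.mp (mem_Icc_ceil_floor_iff.mp hk)
    have hlt := abs_le.mp (mem_Icc_ceil_floor_iff.mp hl)
    have hdvd : (q : ℤ) ∣ k - l :=
      ⟨m l - m k, by linear_combination hnm l - hnm k + a * congrArg (Nat.cast : ℕ → ℤ) hkl⟩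
    have hlt : |(k : ℝ) - l| < q := by
      rw [abs_lt]
      constructor <;> nlinarith
    exact sub_eq_zero.mp (Int.eq_zero_of_abs_lt_dvd hdvd (by exact_mod_cast hlt))
  calc 2 * ρ * q - 3 = 2 * (q * ρ - 1) - 1 := by ring
    _ ≤ #(Icc ⌈t - (q * ρ - 1)⌉ ⌊t + (q * ρ - 1)⌋) := le_card_Icc_ceil_floor t _
    _ ≤ #(bohrSetOn (Ico s (s + q)) γ β ρ) := by
        exact_mod_cast card_le_card_of_injOn n hmaps hinj

theorem card_bohrSetOn_Ico_le (h : IsDirichletApprox β a q) (s L : ℕ) (γ : ℝ) {ρ : ℝ}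
    (hρ : 3 ≤ ρ * q) : (#(bohrSetOn (Ico s (s + L)) γ β ρ) : ℝ) ≤ 3 * ρ * (L + q) := by
  have hq : (0 : ℝ) < q := Nat.cast_pos.mpr h.pos
  have hρ₀ : 0 ≤ ρ := (pos_of_mul_pos_left (by linarith) hq.le).le
  have hL : L ≤ (L / q + 1) * q := by
    have := Nat.lt_div_mul_add h.pos (a := L)
    linarith
  calc (#(bohrSetOn (Ico s (s + L)) γ β ρ) : ℝ)
      ≤ #(bohrSetOn (Ico s (s + (L / q + 1) * q)) γ β ρ) := by
        gcongr
        exact bohrSetOn_subset_bohrSetOn (Ico_subset_Ico_right (by omega)) γ β ρ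
    _ ≤ ∑ i ∈ range (L / q + 1), (2 * ρ * q + 3) := by
        rw [card_bohrSetOn_Ico_add_mul]
        push_cast
        exact sum_le_sum fun i _ => h.card_bohrSetOn_block_le _ γ hρ₀
    _ = ((L / q : ℕ) + 1) * (2 * ρ * q + 3) := by
        rw [sum_const, card_range, nsmul_eq_mul, Nat.cast_add_one]
    _ ≤ ((L : ℝ) / q + 1) * (3 * (ρ * q)) := by
        gcongr
        · exact Nat.cast_div_le
        · linarith
    _ = 3 * ρ * (L + q) := by field_simp

theorem le_card_bohrSetOn_Ico (h : IsDirichletApprox β a q) (s L : ℕ) (γ : ℝ) {ρ : ℝ}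
    (hρ : 3 ≤ ρ * q) (hρ₁ : ρ ≤ 1 / 2) :
    ρ * (L - q) ≤ (#(bohrSetOn (Ico s (s + L)) γ β ρ) : ℝ) := by
  have hq : (0 : ℝ) < q := Nat.cast_pos.mpr h.pos
  have hρ₀ : 0 ≤ ρ := (pos_of_mul_pos_left (by linarith) hq.le).le
  have hL : (L : ℝ) ≤ (L / q : ℕ) * q + q := by exact_mod_cast (Nat.lt_div_mul_add h.pos).le
  calc ρ * (L - q) ≤ ρ * ((L / q : ℕ) * q) := by gcongr; linarith
    _ = (L / q : ℕ) * (ρ * q) := by ring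
    _ ≤ (L / q : ℕ) * (2 * ρ * q - 3) := by gcongr; linarith
    _ = ∑ i ∈ range (L / q), (2 * ρ * q - 3) := by
        rw [sum_const, card_range, nsmul_eq_mul]
    _ ≤ #(bohrSetOn (Ico s (s + L / q * q)) γ β ρ) := by
        rw [card_bohrSetOn_Ico_add_mul]
        push_cast
        exact sum_le_sum fun i _ => h.le_card_bohrSetOn_block _ γ hρ₁
    _ ≤ #(bohrSetOn (Ico s (s + L)) γ β ρ) := by
        gcongr
        refine bohrSetOn_subset_bohrSetOn (Ico_subset_Ico_right ?_) γ β ρ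
        exact Nat.add_le_add_left (Nat.div_mul_le_self L q) s

end IsDirichletApprox

theorem card_filter_dvd_bohrSet_le_card_bohrSetOn (N : ℕ) (γ α ρ : ℝ) {d : ℕ} (hd : 0 < d) :
    #{n ∈ bohrSet N γ α ρ | d ∣ n} ≤ #(bohrSetOn (Ico 1 (1 + N / d)) γ (d * α) ρ) := by
  refine card_le_card_of_injOn (· / d) (fun n hn => ?_) fun n hn m hm h => ?_
  · simp only [bohrSet, coe_filter, mem_filter, mem_Icc, Set.mem_ofPred_eq] at hn
    obtain ⟨⟨⟨hn₁, hnN⟩, hnρ⟩, k, rfl⟩ := hn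
    simp only [mem_coe, mem_bohrSetOn, mem_Ico, Nat.mul_div_cancel_left k hd]
    refine ⟨⟨Nat.pos_of_mul_pos_left hn₁, ?_⟩, by convert hnρ using 3; push_cast; ring⟩
    have := (Nat.le_div_iff_mul_le hd).mpr ((mul_comm k d).trans_le hnN)
    omega
  · exact (Nat.div_left_inj (mem_filter.mp hn).2 (mem_filter.mp hm).2).mp h

theorem IsDirichletApprox.card_filter_dvd_bohrSet_le {α : ℝ} {a : ℤ} {q d N : ℕ}
    (h : IsDirichletApprox (d * α) a q) (hd : 0 < d) (hqd : q * d ≤ N) (γ : ℝ) {ρ : ℝ}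
    (hρ : 3 ≤ ρ * q) : (#{n ∈ bohrSet N γ α ρ | d ∣ n} : ℝ) ≤ 6 * (ρ * N) / d := by
  have hd' : (0 : ℝ) < d := Nat.cast_pos.mpr hd
  have hρ₀ : 0 ≤ ρ := (pos_of_mul_pos_left (by linarith) (Nat.cast_nonneg q)).le
  have hq : (q : ℝ) ≤ N / d := by
    rw [le_div_iff₀ hd']
    exact_mod_cast hqd
  calc (#{n ∈ bohrSet N γ α ρ | d ∣ n} : ℝ)
      ≤ #(bohrSetOn (Ico 1 (1 + N / d)) γ (d * α) ρ) := by
        exact_mod_cast card_filter_dvd_bohrSet_le_card_bohrSetOn N γ α ρ hd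
    _ ≤ 3 * ρ * ((N / d : ℕ) + q) := h.card_bohrSetOn_Ico_le 1 (N / d) γ hρ
    _ ≤ 3 * ρ * (N / d + N / d) := by
        gcongr
        exact Nat.cast_div_le
    _ = 6 * (ρ * N) / d := by ring

theorem IsDirichletApprox.le_card_bohrSetStar {α : ℝ} {a : ℤ} {q N : ℕ}
    (h : IsDirichletApprox α a q) (hqN : (q : ℝ) ≤ 9 / 20 * N) (γ : ℝ) {ρ : ℝ}
    (hρ : 3 ≤ ρ * q) (hρ₁ : ρ ≤ 1 / 2) : ρ * N / 2 ≤ #(bohrSetStar N γ α ρ) := by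
  have hq : (0 : ℝ) < q := Nat.cast_pos.mpr h.pos
  have hρ₀ : 0 ≤ ρ := (pos_of_mul_pos_left (by linarith) hq.le).le
  have hN : (0 : ℝ) < N := by linarith
  set s := ⌈(N : ℝ) / 20⌉₊
  have hs₀ : 0 < s := Nat.ceil_pos.mpr (by positivity)
  have hs : (s : ℝ) < N / 20 + 1 := Nat.ceil_lt_add_one (by positivity)
  have hsN : s ≤ N := Nat.ceil_le.mpr (by linarith)
  have hsub : bohrSetOn (Ico s (s + (N + 1 - s))) γ α ρ ⊆ bohrSetStar N γ α ρ := by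
    intro n hn
    obtain ⟨hns, hnρ⟩ := mem_bohrSetOn.mp hn
    rw [mem_Ico] at hns
    simp only [bohrSetStar, bohrSet, mem_filter, mem_Icc]
    exact ⟨⟨⟨by omega, by omega⟩, hnρ⟩, Nat.ceil_le.mp hns.1⟩
  calc ρ * N / 2 = ρ * (N / 2) := by ring
    _ ≤ ρ * ((N + 1 - s : ℕ) - q) := by
        gcongr
        push_cast [Nat.cast_sub (by omega : s ≤ N + 1)]
        linarith
    _ ≤ #(bohrSetOn (Ico s (s + (N + 1 - s))) γ α ρ) := h.le_card_bohrSetOn_Ico s _ γ hρ hρ₁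
    _ ≤ #(bohrSetStar N γ α ρ) := by exact_mod_cast card_le_card hsub

theorem exists_isDirichletApprox (β : ℝ) {Q : ℝ} (hQ : 1 ≤ Q) :
    ∃ (a : ℤ) (q : ℕ), IsDirichletApprox β a q ∧ q ≤ Q ∧ distNearestInt (q * β) ≤ 1 / Q := by
  obtain ⟨r, hr, hden⟩ := Real.exists_rat_abs_sub_le_and_den_le β (Nat.floor_pos.mpr hQ)
  have hr₀ : (0 : ℝ) < r.den := Nat.cast_pos.mpr r.den_pos
  have hQlt : Q < ⌊Q⌋₊ + 1 := Nat.lt_floor_add_one Q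
  have hdenQ : (r.den : ℝ) ≤ Q := (Nat.le_floor_iff (by linarith)).mp hden
  rw [Rat.cast_def] at hr
  refine ⟨r.num, r.den, ⟨r.den_pos, r.isCoprime_num_den, hr.trans ?_⟩, hdenQ,
    distNearestInt_le_iff.mpr ⟨r.num, ?_⟩⟩
  · rw [pow_two]
    gcongr
    linarith
  · calc |(r.den : ℝ) * β - r.num| = r.den * |β - r.num / r.den| := by
          rw [show (r.den : ℝ) * β - r.num = r.den * (β - r.num / r.den) by field_simp, abs_mul,
            Nat.abs_cast]
      _ ≤ r.den * (1 / ((⌊Q⌋₊ + 1) * r.den)) := by gcongr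
      _ = 1 / (⌊Q⌋₊ + 1) := by field_simp
      _ ≤ 1 / Q := by gcongr

theorem diophantineExponent_nonneg (α : ℝ) : 0 ≤ diophantineExponent α :=
  Real.sSup_nonneg fun _ hw => hw.1.le

section NotLiouville

variable {α : ℝ}

theorem exists_one_div_pow_le_distNearestInt (hα : Irrational α) (hL : ¬ Liouville α) :
    ∃ k : ℕ, ∀ n : ℕ, 1 < n → 1 / (n : ℝ) ^ k ≤ distNearestInt (n * α) := by
  unfold Liouville at hL
  push Not at hL
  obtain ⟨k, hk⟩ := hL
  refine ⟨k, fun n hn => ?_⟩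
  have hn₁ : (1 : ℝ) ≤ n := by exact_mod_cast hn.le
  set m := round ((n : ℝ) * α) with hm
  have hne : α ≠ m / (n : ℤ) := by
    simpa only [Rat.cast_div, Rat.cast_intCast] using hα.ne_rat ((m : ℚ) / (n : ℤ))
  calc 1 / (n : ℝ) ^ k ≤ |α - m / n| := by
        simpa only [Int.cast_natCast] using hk m n (by exact_mod_cast hn) hne
    _ ≤ n * |α - m / n| := le_mul_of_one_le_left (abs_nonneg _) hn₁
    _ = distNearestInt (n * α) := by
        rw [← Nat.abs_cast, ← abs_mul, Nat.abs_cast, distNearestInt, ← hm]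
        congr 1
        field_simp

theorem bddAbove_setOf_infinite_distNearestInt_lt_rpow_neg (hα : Irrational α)
    (hL : ¬ Liouville α) :
    BddAbove {w : ℝ | 0 < w ∧
      {n : ℕ | 1 ≤ n ∧ distNearestInt (n * α) < (n : ℝ) ^ (-w)}.Infinite} := by
  obtain ⟨k, hk⟩ := exists_one_div_pow_le_distNearestInt hα hL
  refine ⟨k, fun w ⟨_, hw⟩ => ?_⟩
  obtain ⟨n, ⟨_, hnw⟩, hn⟩ := hw.exists_gt 1
  have hn' : (1 : ℝ) < n := by exact_mod_cast hn
  have hlt : (n : ℝ) ^ (-(k : ℝ)) < (n : ℝ) ^ (-w) := by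
    rw [Real.rpow_neg (Nat.cast_nonneg n), Real.rpow_natCast, ← one_div]
    exact (hk n hn).trans_lt hnw
  linarith [(Real.rpow_lt_rpow_left_iff hn').mp hlt]

theorem exists_rpow_neg_le_mul_distNearestInt (hα : Irrational α) (hL : ¬ Liouville α) {w : ℝ}
    (hw : diophantineExponent α < w) :
    ∃ C > 0, ∀ n : ℕ, 0 < n → (n : ℝ) ^ (-w) ≤ C * distNearestInt (n * α) := by
  have hfin : {n : ℕ | 1 ≤ n ∧ distNearestInt (n * α) < (n : ℝ) ^ (-w)}.Finite := by
    by_contra hinf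
    exact hw.not_ge (le_csSup (bddAbove_setOf_infinite_distNearestInt_lt_rpow_neg hα hL)
      ⟨(diophantineExponent_nonneg α).trans_lt hw, hinf⟩)
  have hO : (fun n : ℕ => (n : ℝ) ^ (-w)) =O[atTop] fun n => distNearestInt (n * α) := by
    refine .of_bound 1 ?_
    rw [← Nat.cofinite_eq_atTop]
    filter_upwards [hfin.compl_mem_cofinite, (Set.finite_singleton 0).compl_mem_cofinite]
      with n hn hn₀
    have hle : (n : ℝ) ^ (-w) ≤ distNearestInt (n * α) :=
      not_lt.mp fun hlt => hn ⟨Nat.one_le_iff_ne_zero.mpr hn₀, hlt⟩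
    rw [Real.norm_of_nonneg (by positivity), Real.norm_of_nonneg (distNearestInt_nonneg _)]
    linarith
  obtain ⟨C, hC, hbound⟩ := bound_of_isBigO_nat_atTop hO
  refine ⟨C, hC, fun n hn => ?_⟩
  have hpos := distNearestInt_pos_of_irrational (hα.natCast_mul hn.ne')
  have hle := hbound hpos.ne'
  rwa [Real.norm_of_nonneg (by positivity), Real.norm_of_nonneg hpos.le] at hle

/-- A small denominator `q` for `d α` would make `‖q d α‖` smaller than the diophantine exponent
allows. -/
theorem eventually_exists_isDirichletApprox (hα : Irrational α) (hL : ¬ Liouville α) {δ η : ℝ}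
    (hη : 0 < η) (hη₁ : η ≤ 1) (hδη : (δ + η) * (diophantineExponent α + η) < 1 - η) :
    ∀ᶠ N : ℕ in atTop, ∀ d : ℕ, 0 < d → (d : ℝ) ≤ (N : ℝ) ^ η →
      ∃ (a : ℤ) (q : ℕ), IsDirichletApprox (d * α) a q ∧
        3 ≤ (N : ℝ) ^ (-δ) * q ∧ (q : ℝ) ≤ (N : ℝ) ^ (1 - η) := by
  set w := diophantineExponent α + η
  have hw : 0 < w := add_pos_of_nonneg_of_pos (diophantineExponent_nonneg α) hη
  obtain ⟨C, hC, hCα⟩ := exists_rpow_neg_le_mul_distNearestInt hα hL (lt_add_of_pos_right _ hη)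
  have hlim : ∀ᶠ N : ℕ in atTop, C * 3 ^ w < (N : ℝ) ^ (1 - η - (δ + η) * w) :=
    ((tendsto_rpow_atTop (sub_pos.mpr hδη)).comp
      tendsto_natCast_atTop_atTop).eventually_gt_atTop _
  filter_upwards [hlim, eventually_ge_atTop 1] with N hN hN₁ d hd hdN
  have hN₀ : (0 : ℝ) < N := Nat.cast_pos.mpr hN₁
  have hQ : 1 ≤ (N : ℝ) ^ (1 - η) :=
    Real.one_le_rpow (by exact_mod_cast hN₁) (sub_nonneg.mpr hη₁)
  obtain ⟨a, q, hq, hqQ, hdist⟩ := exists_isDirichletApprox (d * α) hQ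
  refine ⟨a, q, hq, ?_, hqQ⟩
  by_contra! hlt
  rw [Real.rpow_neg hN₀.le, inv_mul_lt_iff₀ (by positivity), mul_comm] at hlt
  have hqd₀ : (0 : ℝ) < (q * d : ℕ) := Nat.cast_pos.mpr (Nat.mul_pos hq.pos hd)
  have hqd : ((q * d : ℕ) : ℝ) ≤ 3 * (N : ℝ) ^ (δ + η) := by
    rw [Nat.cast_mul, Real.rpow_add hN₀, ← mul_assoc]
    gcongr
  have hexp : ((q * d : ℕ) : ℝ) ^ (-w) ≤ C * (1 / (N : ℝ) ^ (1 - η)) := by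
    refine (hCα (q * d) (Nat.mul_pos hq.pos hd)).trans ?_
    gcongr
    rwa [Nat.cast_mul, mul_assoc]
  have hle : (N : ℝ) ^ (1 - η) ≤ C * 3 ^ w * (N : ℝ) ^ ((δ + η) * w) := by
    rw [Real.rpow_neg hqd₀.le, mul_one_div, inv_eq_one_div,
      div_le_div_iff₀ (by positivity) (by positivity), one_mul] at hexp
    calc (N : ℝ) ^ (1 - η) ≤ C * ((q * d : ℕ) : ℝ) ^ w := hexp
      _ ≤ C * (3 * (N : ℝ) ^ (δ + η)) ^ w := by gcongr
      _ = C * 3 ^ w * (N : ℝ) ^ ((δ + η) * w) := by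
          rw [Real.mul_rpow (by norm_num) (by positivity), ← Real.rpow_mul hN₀.le, mul_assoc]
  rw [Real.rpow_sub hN₀, lt_div_iff₀ (by positivity)] at hN
  exact hN.not_ge hle

end NotLiouville

/-- The sum of `1 / p` over the primes `p ∣ n`, which controls `φ(n) / n` from below. -/
noncomputable def sumInvPrimeFactors (n : ℕ) : ℝ :=
  ∑ p ∈ n.primeFactors, (p : ℝ)⁻¹

theorem exp_neg_two_mul_le_one_sub {x : ℝ} (h₀ : 0 ≤ x) (h₁ : x ≤ 1 / 2) :
    Real.exp (-(2 * x)) ≤ 1 - x := by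
  rw [Real.exp_neg, inv_le_iff_one_le_mul₀ (Real.exp_pos _)]
  nlinarith [Real.add_one_le_exp (2 * x)]

theorem exp_neg_sumInvPrimeFactors_le_totient_div {n : ℕ} (hn : n ≠ 0) :
    Real.exp (-(2 * sumInvPrimeFactors n)) ≤ (Nat.totient n : ℝ) / n := by
  have htotient : (Nat.totient n : ℝ) = n * ∏ p ∈ n.primeFactors, (1 - (p : ℝ)⁻¹) := by
    simpa using congrArg (Rat.cast : ℚ → ℝ) (Nat.totient_eq_mul_prod_factors n)
  rw [htotient, mul_div_cancel_left₀ _ (Nat.cast_ne_zero.mpr hn), sumInvPrimeFactors, mul_sum,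
    ← sum_neg_distrib, Real.exp_sum]
  refine prod_le_prod (fun _ _ => (Real.exp_pos _).le) fun p hp => ?_
  have hp₂ : (2 : ℝ) ≤ p := by exact_mod_cast (Nat.prime_of_mem_primeFactors hp).two_le
  exact exp_neg_two_mul_le_one_sub (by positivity) (by rw [one_div]; gcongr)

theorem card_primeFactors_le_log_two {n : ℕ} (hn : n ≠ 0) : #n.primeFactors ≤ Nat.log 2 n := by
  refine Nat.le_log_of_pow_le one_lt_two ?_
  calc 2 ^ #n.primeFactors ≤ ∏ p ∈ n.primeFactors, p :=
        pow_card_le_prod _ _ 2 fun p hp => (Nat.prime_of_mem_primeFactors hp).two_le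
    _ ≤ n := Nat.le_of_dvd (Nat.pos_of_ne_zero hn) (Nat.prod_primeFactors_dvd n)

theorem sumInvPrimeFactors_le_sum_Icc_add_one {n : ℕ} {X : ℝ} (hn : n ≠ 0)
    (hX : (Nat.log 2 n : ℝ) ≤ X) (hX₀ : 0 < X) :
    sumInvPrimeFactors n ≤ (∑ d ∈ Icc 1 ⌊X⌋₊ with d ∣ n, (d : ℝ)⁻¹) + 1 := by
  rw [sumInvPrimeFactors, ← sum_filter_add_sum_filter_not n.primeFactors fun p : ℕ => (p : ℝ) ≤ X]
  refine add_le_add ?_ ?_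
  · refine sum_le_sum_of_subset_of_nonneg (fun p hp => ?_) fun _ _ _ => by positivity
    obtain ⟨hpn, hpX⟩ := mem_filter.mp hp
    exact mem_filter.mpr ⟨mem_Icc.mpr ⟨(Nat.prime_of_mem_primeFactors hpn).pos, Nat.le_floor hpX⟩,
      Nat.dvd_of_mem_primeFactors hpn⟩
  · calc ∑ p ∈ n.primeFactors with ¬ (p : ℕ) ≤ X, (p : ℝ)⁻¹
        ≤ #{p ∈ n.primeFactors | ¬ (p : ℕ) ≤ X} • X⁻¹ :=
          sum_le_card_nsmul _ _ _ fun p hp =>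
            inv_anti₀ hX₀ (not_le.mp (mem_filter.mp hp).2).le
      _ ≤ X * X⁻¹ := by
          rw [nsmul_eq_mul]
          gcongr
          refine le_trans ?_ hX
          exact_mod_cast (card_filter_le _ _).trans (card_primeFactors_le_log_two hn)
      _ = 1 := mul_inv_cancel₀ hX₀.ne'

section SparseMultiples

variable {B : Finset ℕ} {N : ℕ} {X A : ℝ}

theorem sum_sumInvPrimeFactors_le (hB : ∀ n ∈ B, n ≠ 0 ∧ n ≤ N) (hX : (Nat.log 2 N : ℝ) ≤ X)
    (hX₁ : 1 ≤ X)
    (hdvd : ∀ d : ℕ, 0 < d → (d : ℝ) ≤ X → (#{n ∈ B | d ∣ n} : ℝ) ≤ A / d) :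
    ∑ n ∈ B, sumInvPrimeFactors n ≤ 3 * A := by
  have hcard : (#B : ℝ) ≤ A := by simpa using hdvd 1 one_pos (by simpa using hX₁)
  have hA : 0 ≤ A := (Nat.cast_nonneg _).trans hcard
  have hlog : ∀ n ∈ B, (Nat.log 2 n : ℝ) ≤ X := fun n hn =>
    (Nat.cast_le.mpr (Nat.log_mono_right (hB n hn).2)).trans hX
  calc ∑ n ∈ B, sumInvPrimeFactors n
      ≤ ∑ n ∈ B, ((∑ d ∈ Icc 1 ⌊X⌋₊ with d ∣ n, (d : ℝ)⁻¹) + 1) :=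
        sum_le_sum fun n hn => sumInvPrimeFactors_le_sum_Icc_add_one (hB n hn).1 (hlog n hn)
          (by linarith)
    _ = (∑ d ∈ Icc 1 ⌊X⌋₊, (#{n ∈ B | d ∣ n} : ℝ) * (d : ℝ)⁻¹) + #B := by
        simp only [sum_add_distrib, sum_filter, sum_const, nsmul_eq_mul, mul_one]
        rw [sum_comm]
        simp only [← sum_filter, sum_const, nsmul_eq_mul]
    _ ≤ (∑ d ∈ Icc 1 ⌊X⌋₊, A * ((d : ℝ) ^ 2)⁻¹) + A := by
        refine add_le_add (sum_le_sum fun d hd => ?_) hcard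
        obtain ⟨hd₁, hdX⟩ := mem_Icc.mp hd
        calc (#{n ∈ B | d ∣ n} : ℝ) * (d : ℝ)⁻¹ ≤ A / d * (d : ℝ)⁻¹ := by
              gcongr
              exact hdvd d hd₁ ((Nat.le_floor_iff (by linarith)).mp hdX)
          _ = A * ((d : ℝ) ^ 2)⁻¹ := by ring
    _ ≤ A * 2 + A := by
        rw [← mul_sum]
        gcongr
        have hIcc : Icc 1 ⌊X⌋₊ = Ioo 0 (⌊X⌋₊ + 1) := by ext; simp only [mem_Icc, mem_Ioo]; omega
        simpa [hIcc] using sum_Ioo_inv_sq_le (α := ℝ) 0 (⌊X⌋₊ + 1)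
    _ = 3 * A := by ring

/-- Jensen's inequality for `x ↦ exp (-2 x)`, by way of its tangent line at `K`. -/
theorem exp_mul_card_le_sum_totient_div {K : ℝ} (hB : ∀ n ∈ B, n ≠ 0)
    (hK : ∑ n ∈ B, sumInvPrimeFactors n ≤ K * #B) :
    Real.exp (-(2 * K)) * #B ≤ ∑ n ∈ B, (Nat.totient n : ℝ) / n := by
  have htangent : ∀ x : ℝ,
      Real.exp (-(2 * K)) * (1 + 2 * (K - x)) ≤ Real.exp (-(2 * x)) := fun x => by
    rw [show -(2 * x) = -(2 * K) + 2 * (K - x) by ring, Real.exp_add]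
    gcongr
    linarith [Real.add_one_le_exp (2 * (K - x))]
  calc Real.exp (-(2 * K)) * #B
      ≤ Real.exp (-(2 * K)) * (#B + 2 * (K * #B - ∑ n ∈ B, sumInvPrimeFactors n)) := by
        gcongr
        linarith
    _ = ∑ n ∈ B, Real.exp (-(2 * K)) * (1 + 2 * (K - sumInvPrimeFactors n)) := by
        simp only [← mul_sum, sum_add_distrib, sum_sub_distrib, sum_const, nsmul_eq_mul, mul_one]
        ring
    _ ≤ ∑ n ∈ B, (Nat.totient n : ℝ) / n := sum_le_sum fun n hn =>
        (htangent _).trans (exp_neg_sumInvPrimeFactors_le_totient_div (hB n hn))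

end SparseMultiples

theorem sum_totient_div_le_card (B : Finset ℕ) : ∑ n ∈ B, (Nat.totient n : ℝ) / n ≤ #B := by
  rw [← nsmul_one, ← sum_const]
  exact sum_le_sum fun n _ =>
    div_le_one_of_le₀ (by exact_mod_cast Nat.totient_le n) (Nat.cast_nonneg n)

theorem eventually_natLog_le_rpow {r : ℝ} (hr : 0 < r) (b : ℕ) :
    ∀ᶠ N : ℕ in atTop, (Nat.log b N : ℝ) ≤ (N : ℝ) ^ r := by
  have ho : (fun N : ℕ => Real.logb b N) =o[atTop] fun N : ℕ => (N : ℝ) ^ r := by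
    simpa only [Real.logb, div_eq_inv_mul, Function.comp_def] using
      ((isLittleO_log_rpow_atTop hr).const_mul_left (Real.log b)⁻¹).comp_tendsto
        tendsto_natCast_atTop_atTop
  filter_upwards [ho.bound one_pos] with N hN
  rw [one_mul, Real.norm_of_nonneg (by positivity : 0 ≤ (N : ℝ) ^ r)] at hN
  exact (Real.natLog_le_logb N b).trans ((le_abs_self _).trans hN)

theorem exists_pos_add_mul_add_lt_one_sub {x y : ℝ} (hxy : x * y < 1) :
    ∃ η > 0, η < 1 ∧ (x + η) * (y + η) < 1 - η := by
  have hcont : Continuous fun η : ℝ => (x + η) * (y + η) + η := by fun_prop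
  have hsmall : ∀ᶠ η in 𝓝 (0 : ℝ), (x + η) * (y + η) + η < 1 :=
    hcont.continuousAt.eventually_lt_const (by simpa using hxy)
  obtain ⟨η, ⟨hη, hη₁⟩, hη₀⟩ := (((hsmall.and (eventually_lt_nhds one_pos)).filter_mono
    nhdsWithin_le_nhds).and (self_mem_nhdsWithin (s := Set.Ioi 0))).exists
  exact ⟨η, hη₀, hη₁, lt_sub_iff_add_lt.mpr hη⟩

section BohrSetStar

variable {α δ η : ℝ}

theorem bohrSetStar_subset_bohrSet (N : ℕ) (γ α ρ : ℝ) : bohrSetStar N γ α ρ ⊆ bohrSet N γ α ρ :=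
  filter_subset _ _

theorem eventually_le_card_bohrSetStar (hα : Irrational α) (hL : ¬ Liouville α)
    (hη : 0 < η) (hη₁ : η ≤ 1) (hδη : (δ + η) * (diophantineExponent α + η) < 1 - η) :
    ∀ᶠ N : ℕ in atTop, ∀ γ ρ : ℝ, (N : ℝ) ^ (-δ) ≤ ρ → ρ ≤ 1 / 2 →
      ρ * N / 2 ≤ #(bohrSetStar N γ α ρ) := by
  have hlim : ∀ᶠ N : ℕ in atTop, (N : ℝ) ^ (-η) < 9 / 20 :=
    ((tendsto_rpow_neg_atTop hη).comp tendsto_natCast_atTop_atTop).eventually_lt_const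
      (by norm_num)
  filter_upwards [eventually_exists_isDirichletApprox hα hL hη hη₁ hδη, hlim,
    eventually_ge_atTop 1] with N happrox hN hN₁ γ ρ hρ hρ₁
  have hN₀ : (0 : ℝ) < N := Nat.cast_pos.mpr hN₁
  obtain ⟨a, q, hq, hρq, hqN⟩ := happrox 1 one_pos
    (by simpa using Real.one_le_rpow (Nat.one_le_cast.mpr hN₁) hη.le)
  rw [Nat.cast_one, one_mul] at hq
  have hqN' : (q : ℝ) ≤ 9 / 20 * N :=
    calc (q : ℝ) ≤ (N : ℝ) ^ (1 - η) := hqN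
      _ = (N : ℝ) ^ (-η) * N := by rw [sub_eq_neg_add, Real.rpow_add_one hN₀.ne']
      _ ≤ 9 / 20 * N := by gcongr
  exact hq.le_card_bohrSetStar hqN' γ (hρq.trans (by gcongr)) hρ₁

theorem eventually_card_filter_dvd_bohrSetStar_le (hα : Irrational α) (hL : ¬ Liouville α)
    (hη : 0 < η) (hη₁ : η ≤ 1) (hδη : (δ + η) * (diophantineExponent α + η) < 1 - η) :
    ∀ᶠ N : ℕ in atTop, ∀ γ ρ : ℝ, (N : ℝ) ^ (-δ) ≤ ρ →
      ∀ d : ℕ, 0 < d → (d : ℝ) ≤ (N : ℝ) ^ η →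
        (#{n ∈ bohrSetStar N γ α ρ | d ∣ n} : ℝ) ≤ 6 * (ρ * N) / d := by
  filter_upwards [eventually_exists_isDirichletApprox hα hL hη hη₁ hδη, eventually_ge_atTop 1]
    with N happrox hN₁ γ ρ hρ d hd hdN
  have hN₀ : (0 : ℝ) < N := Nat.cast_pos.mpr hN₁
  obtain ⟨a, q, hq, hρq, hqN⟩ := happrox d hd hdN
  have hqd : (q : ℝ) * d ≤ N :=
    calc (q : ℝ) * d ≤ (N : ℝ) ^ (1 - η) * (N : ℝ) ^ η := by gcongr
      _ = N := by rw [← Real.rpow_add hN₀, sub_add_cancel, Real.rpow_one]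
  calc (#{n ∈ bohrSetStar N γ α ρ | d ∣ n} : ℝ) ≤ #{n ∈ bohrSet N γ α ρ | d ∣ n} := by
        gcongr
        exact bohrSetStar_subset_bohrSet N γ α ρ
    _ ≤ 6 * (ρ * N) / d :=
        hq.card_filter_dvd_bohrSet_le hd (by exact_mod_cast hqd) γ (hρq.trans (by gcongr))

theorem corollary3p5_general (hα : Irrational α) (hL : ¬ Liouville α)
    (hδ : δ * diophantineExponent α < 1) :
    ∀ᶠ N : ℕ in atTop, ∀ γ ρ : ℝ, (N : ℝ) ^ (-δ) ≤ ρ → ρ ≤ 1 / 2 →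
      Real.exp (-72) / 2 * (ρ * N) ≤ ∑ n ∈ bohrSetStar N γ α ρ, (Nat.totient n : ℝ) / n ∧
      ∑ n ∈ bohrSetStar N γ α ρ, (Nat.totient n : ℝ) / n ≤ 6 * (ρ * N) := by
  obtain ⟨η, hη, hη₁, hδη⟩ := exists_pos_add_mul_add_lt_one_sub hδ
  filter_upwards [eventually_le_card_bohrSetStar hα hL hη hη₁.le hδη,
    eventually_card_filter_dvd_bohrSetStar_le hα hL hη hη₁.le hδη,
    eventually_natLog_le_rpow hη 2, eventually_ge_atTop 1] with N hcard hdvd hlog hN γ ρ hρ hρ₁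
  specialize hcard γ ρ hρ hρ₁
  specialize hdvd γ ρ hρ
  have hX : 1 ≤ (N : ℝ) ^ η := Real.one_le_rpow (Nat.one_le_cast.mpr hN) hη.le
  have hB : ∀ n ∈ bohrSetStar N γ α ρ, n ≠ 0 ∧ n ≤ N := fun n hn =>
    have hn := mem_Icc.mp (mem_filter.mp (bohrSetStar_subset_bohrSet N γ α ρ hn)).1
    ⟨Nat.one_le_iff_ne_zero.mp hn.1, hn.2⟩
  constructor
  · have hmean : ∑ n ∈ bohrSetStar N γ α ρ, sumInvPrimeFactors n ≤
        36 * #(bohrSetStar N γ α ρ) := by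
      linarith [sum_sumInvPrimeFactors_le hB hlog hX hdvd]
    calc Real.exp (-72) / 2 * (ρ * N) = Real.exp (-(2 * 36)) * (ρ * N / 2) := by ring_nf
      _ ≤ Real.exp (-(2 * 36)) * #(bohrSetStar N γ α ρ) := by gcongr
      _ ≤ ∑ n ∈ bohrSetStar N γ α ρ, (Nat.totient n : ℝ) / n :=
          exp_mul_card_le_sum_totient_div (fun n hn => (hB n hn).1) hmean
  · calc ∑ n ∈ bohrSetStar N γ α ρ, (Nat.totient n : ℝ) / n
        ≤ #(bohrSetStar N γ α ρ) := sum_totient_div_le_card _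
      _ ≤ 6 * (ρ * N) := by simpa using hdvd 1 one_pos (by simpa using hX)

end BohrSetStar

theorem bohrEps_pos (α : ℝ) : 0 < bohrEps α := by
  have := diophantineExponent_nonneg α
  unfold bohrEps
  positivity

theorem two_mul_bohrEps_mul_diophantineExponent_lt_one (α : ℝ) :
    2 * bohrEps α * diophantineExponent α < 1 := by
  have := diophantineExponent_nonneg α
  rw [bohrEps, mul_one_div, div_mul_eq_mul_div, div_lt_one (by positivity)]
  linarith

theorem eventually_rpow_neg_bohrEps_le_half (α : ℝ) :
    ∀ᶠ N : ℕ in atTop, (N : ℝ) ^ (-bohrEps α) ≤ 1 / 2 :=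
  ((tendsto_rpow_neg_atTop (bohrEps_pos α)).comp tendsto_natCast_atTop_atTop).eventually_le_const
    (by norm_num)

theorem corollary3p5 (α : ℝ) (hα : Irrational α) (hL : ¬ Liouville α) :
    ∃ c C : ℝ, 0 < c ∧ 0 < C ∧ ∃ N₀ : ℕ, ∀ (γ : ℝ) (N : ℕ) (ρ : ℝ), N₀ ≤ N →
      (N : ℝ) ^ (-2 * bohrEps α) ≤ ρ → ρ ≤ (N : ℝ) ^ (-bohrEps α) →
        c * (ρ * N) ≤ ∑ n ∈ bohrSetStar N γ α ρ, (Nat.totient n : ℝ) / n ∧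
        ∑ n ∈ bohrSetStar N γ α ρ, (Nat.totient n : ℝ) / n ≤ C * (ρ * N) := by
  obtain ⟨N₀, hN₀⟩ := eventually_atTop.mp ((corollary3p5_general hα hL
    (two_mul_bohrEps_mul_diophantineExponent_lt_one α)).and (eventually_rpow_neg_bohrEps_le_half α))
  exact ⟨Real.exp (-72) / 2, 6, by positivity, by norm_num, N₀, fun γ N ρ hN hρ hρ₁ =>
    (hN₀ N hN).1 γ ρ (by rwa [← neg_mul]) (hρ₁.trans (hN₀ N hN).2)⟩
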